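/- Let $X$ be a locally compact Hausdorff space (not necessarily second countable), let $U\subset X$ be open, and let $\sigma\colon U\to X$ be a local homeomorphism; write $\Sigma=(X,\sigma)$. Put $U_0=X$ and $U_{n+1}=\{x\in U_n\mid \sigma^n(x)\in U\}$, so that $\sigma^n$ has domain $U_n$; an equation involving $\sigma^n(x)$ tacitly includes $x\in U_n$. Let $\mathbb T=\{z\in\mathbb C\mid |z|=1\}$. The C*-algebra $C^*(\Sigma)$ is the universal C*-algebra generated by the images of a *-homomorphism $t^0\colon C_0(X)\to C^*(\Sigma)$ and a linear map $t^1\colon C_c(U)\to C^*(\Sigma)$ satisfying (a) $t^1(\xi)^*t^1(\eta)=t^0(\langle\xi,\eta\rangle)$ for $\xi,\eta\in C_c(U)$, where $\langle\xi,\eta\rangle(x)=\sum_{\sigma(y)=x}\overline{\xi(y)}\,\eta(y)$, and (b) $t^1(\xi)t^1(\eta)^*=t^0(\xi\overline\eta)$ for $\xi,\eta\in C_c(V)$ whenever $V\subset U$ is an open set on which $\sigma$ is injective. For $x_0\in X$ let $\mathrm{Orb}(x_0)=\{x\in X\mid \sigma^n(x)=\sigma^m(x_0)\text{ for some }n,m\in\mathbb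 N\}$, and let $H_{x_0}$ be the Hilbert space with orthonormal basis $\{\delta_x\}_{x\in \mathrm{Orb}(x_0)}$. For $\gamma_0\in\mathbb T$ let $\pi_{(x_0,\gamma_0)}\colon C^*(\Sigma)\to B(H_{x_0})$ be the representation determined by $$\pi_{(x_0,\gamma_0)}(t^0(f))\delta_x=f(x)\delta_x,\qquad \pi_{(x_0,\gamma_0)}(t^1(\xi))\delta_x=\gamma_0\sum_{\sigma(y)=x}\xi(y)\delta_y ,$$ and put $P_{(x_0,\gamma_0)}=\ker\pi_{(x_0,\gamma_0)}$. For $Y\subset X\times\mathbb T$ and for an ideal $I$ of $C^*(\Sigma)$ let $$I_Y=\bigcap_{(x,\gamma)\in Y}P_{(x,\gamma)},\qquad Y_I=\{(x,\gamma)\in X\times\mathbb T\mid I\subset P_{(x,\gamma)}\},$$ where $I_\emptyset=C^*(\Sigma)$. A point $x\in X$ is periodic if $\sigma^{k+n}(x)=\sigma^k(x)$ for some $k\ge 0$, $n\ge1$; its period $p(x)$ is then the least $n\geq 1$ that occurs for some $k$, and $l(x)$ is the least $k\geq 0$ with $\sigma^{k+p(x)}(x)=\sigma^k(x)$. If $x$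 is not periodic, $p(x)=l(x)=\infty$. For $Y\subset X\times\mathbb T$ and $x\in X$ put $Y_x=\{\gamma\in\mathbb T\mid (x,\gamma)\in Y\}$, and let $\zeta_n=e^{2\pi i/n}$ for $n\ge1$. The set $Y$ is called admissible if (i) $Y$ is closed in $X\times\mathbb T$; (ii) $Y_x=Y_{\sigma(x)}$ for all $x\in U$; (iii) whenever $Y_{x_0}\ne\emptyset$ and $Y_{x_0}\neq\mathbb T$, the point $x_0$ is periodic, $\zeta_{p(x_0)}Y_{x_0}=Y_{x_0}$, and $x_0$ has a neighbourhood $V$ such that $Y_x=\emptyset$ for all $x\in V$ with $l(x)\ne l(x_0)$. **Proposition.** For every admissible subset $Y$ of $X\times\mathbb T$ we have $Y_{I_Y}=Y$. -/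

import Mathlib

open scoped ZeroAtInfty CompactlySupported ENNReal ComplexConjugate

universe u v

set_option linter.unusedSectionVars false

/-- A singly generated dynamical system on `X`: a local homeomorphism `σ : U → X` defined on an
open subset `U` of `X`. -/
structure SGDS (X : Type u) [TopologicalSpace X] where
  /-- the domain of `σ` -/
  U : TopologicalSpace.Opens X
  /-- the map `σ` -/
  σ : U → X
  isLocalHomeomorph : IsLocalHomeomorph σ

namespace SGDS

section Dynamics

variable {X : Type u} [TopologicalSpace X] (S : SGDS X)

open scoped Classical in
/-- The partial map `σ` as a map into `Option X`. -/
noncomputable def step (x : X) : Option X :=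
  if h : x ∈ S.U then some (S.σ ⟨x, h⟩) else none

/-- The iterates of the partial map `σ`: `S.iter n x = some y` means that `x` lies in the domain
`U_n` of `σ^n` and that `σ^n(x) = y`. -/
noncomputable def iter : ℕ → X → Option X
  | 0, x => some x
  | n + 1, x => (iter n x).bind S.step

/-- `σ^n(x) = σ^m(x')`, both sides being defined. -/
def IterEq (n : ℕ) (x : X) (m : ℕ) (x' : X) : Prop :=
  ∃ y, S.iter n x = some y ∧ S.iter m x' = some y

/-- The orbit `{x | σ^n(x) = σ^m(x₀) for some n, m}` of `x₀`. -/
def orbit (x₀ : X) : Set X := {x | ∃ n m, S.IterEq n x m x₀}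

/-- `x` is periodic if `σ^(k+n)(x) = σ^k(x)` for some `k` and some `n ≥ 1`. -/
def IsPeriodic (x : X) : Prop := ∃ k n, 1 ≤ n ∧ S.IterEq (k + n) x k x

/-- The period `p(x)`: the least `n ≥ 1` with `σ^(k+n)(x) = σ^k(x)` for some `k`, and `∞` if `x`
is aperiodic. -/
noncomputable def period (x : X) : ℕ∞ :=
  sInf {p | ∃ n : ℕ, p = n ∧ 1 ≤ n ∧ ∃ k, S.IterEq (k + n) x k x}

/-- `l(x)`: the least `k` with `σ^(k+p(x))(x) = σ^k(x)`, and `∞` if `x` is aperiodic. -/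
noncomputable def preperiod (x : X) : ℕ∞ :=
  sInf {l | ∃ k n : ℕ, l = k ∧ S.period x = n ∧ S.IterEq (k + n) x k x}

variable {S}

theorem step_of_mem (y : S.U) : S.step y = some (S.σ y) := by
  simp [step]

theorem iter_succ' (n : ℕ) (x : X) : S.iter (n + 1) x = (S.step x).bind (S.iter n) := by
  induction n with
  | zero =>
    simp [iter]
  | succ n ih =>
    have h : S.iter (n + 1) = fun x => (S.iter n x).bind S.step := rfl
    rw [iter, ih, h, Option.bind_assoc]

theorem mem_orbit_self (x : X) : x ∈ S.orbit x := ⟨0, 0, x, rfl, rfl⟩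

/-- Orbits are invariant under `σ` and under taking preimages. -/
theorem map_mem_orbit_iff (x₀ : X) (y : S.U) : S.σ y ∈ S.orbit x₀ ↔ (y : X) ∈ S.orbit x₀ := by
  constructor
  · rintro ⟨n, m, z, h₁, h₂⟩
    exact ⟨n + 1, m, z, by simpa [iter_succ', step_of_mem] using h₁, h₂⟩
  · rintro ⟨n, m, z, h₁, h₂⟩
    cases n with
    | zero =>
      obtain rfl : (y : X) = z := by simpa [iter] using h₁
      exact ⟨0, m + 1, S.σ y, rfl, by simp [iter, h₂, step_of_mem]⟩
    | succ n => exact ⟨n, m, z, by simpa [iter_succ', step_of_mem] using h₁, h₂⟩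

end Dynamics

section Functions

variable {X : Type u} [TopologicalSpace X] [T2Space X] (S : SGDS X)

theorem finite_fiber_inter (θ : C_c(S.U, ℂ)) (x : X) :
    (S.σ ⁻¹' {x} ∩ tsupport θ).Finite := by
  have hcl : IsClosed (S.σ ⁻¹' {x}) := isClosed_singleton.preimage S.isLocalHomeomorph.continuous
  have hK : IsCompact (S.σ ⁻¹' {x} ∩ tsupport θ) := θ.hasCompactSupport.isCompact.inter_left hcl
  choose e hye he using S.isLocalHomeomorph
  obtain ⟨t, htK, ht⟩ := hK.elim_nhds_subcover (fun y => (e y).source)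
    fun y _ => (e y).open_source.mem_nhds (hye y)
  refine t.finite_toSet.subset fun z hz => ?_
  obtain ⟨y, hyt, hzy⟩ := Set.mem_iUnion₂.1 (ht hz)
  have hyK := htK y hyt
  have : z = y := (e y).injOn hzy (hye y) <| by
    rw [← he y]
    exact hz.1.trans hyK.1.symm
  exact this ▸ hyt

/-- The function `x ↦ ∑_{σ(y) = x} θ(y)`. -/
noncomputable def fiberSumFun (θ : C_c(S.U, ℂ)) (x : X) : ℂ := ∑ᶠ y ∈ S.σ ⁻¹' {x}, θ y

theorem continuous_fiberSumFun (θ : C_c(S.U, ℂ)) : Continuous (S.fiberSumFun θ) := by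
  classical
  rw [continuous_iff_continuousAt]
  intro x
  have hF := S.finite_fiber_inter θ x
  obtain ⟨O, hO, hdisj⟩ := hF.t2_separation
  choose e hye he using S.isLocalHomeomorph
  set V : S.U → Set S.U := fun y => O y ∩ (e y).source with hV
  have hVo : ∀ y, IsOpen (V y) := fun y => (hO y).2.inter (e y).open_source
  have hyV : ∀ y, y ∈ V y := fun y => ⟨(hO y).1, hye y⟩
  have hsymm : ∀ y, S.σ y = x → (e y).symm x = y := by
    intro y hy
    rw [← hy]
    nth_rewrite 1 [he y]
    exact (e y).left_inv (hye y)
  have hxt : ∀ y, S.σ y = x → x ∈ (e y).target := by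
    intro y hy
    rw [← hy]
    nth_rewrite 1 [he y]
    exact (e y).map_source (hye y)
  have hcs : ∀ y, S.σ y = x → ContinuousAt (e y).symm x := fun y hy =>
    (e y).continuousAt_symm (hxt y hy)
  have hev1 : ∀ᶠ x' in nhds x, x' ∉ S.σ '' (tsupport θ \ ⋃ y ∈ hF.toFinset, V y) := by
    have hc : IsCompact (tsupport θ \ ⋃ y ∈ hF.toFinset, V y) :=
      θ.hasCompactSupport.isCompact.diff (isOpen_biUnion fun y _ => hVo y)
    refine (hc.image S.isLocalHomeomorph.continuous).isClosed.isOpen_compl.mem_nhds ?_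
    rintro ⟨z, ⟨hz, hzV⟩, hzx⟩
    refine hzV (Set.mem_biUnion (x := z) ?_ (hyV z))
    simpa using ⟨hzx, hz⟩
  have hev2 : ∀ᶠ x' in nhds x, ∀ y ∈ hF.toFinset,
      (e y).symm x' ∈ V y ∧ x' ∈ (e y).target := by
    rw [Filter.eventually_all_finset]
    intro y hy
    have hy' : S.σ y = x := by simpa using ((Set.Finite.mem_toFinset _).1 hy).1
    refine Filter.Eventually.and ?_ ((e y).open_target.mem_nhds (hxt y hy'))
    refine (hcs y hy').eventually_mem ((hVo y).mem_nhds ?_)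
    rw [hsymm y hy']
    exact hyV y
  have key : (fun x' => ∑ y ∈ hF.toFinset, θ ((e y).symm x')) =ᶠ[nhds x] S.fiberSumFun θ := by
    filter_upwards [hev1, hev2] with x' h1 h2
    have hinj : Set.InjOn (fun y => (e y).symm x') (hF.toFinset : Set S.U) := by
      intro y hy y' hy' hyy
      by_contra hne
      have hd := hdisj (by simpa using hy) (by simpa using hy') hne
      refine Set.disjoint_left.1 hd (h2 y hy).1.1 ?_
      have := (h2 y' hy').1.1
      simp only at hyy
      rwa [← hyy] at this
    rw [fiberSumFun, ← Finset.sum_image (f := fun z => θ z) (g := fun y => (e y).symm x') hinj]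
    symm
    refine finsum_mem_eq_sum_of_inter_support_eq _ ?_
    ext z
    simp only [Set.mem_inter_iff, Set.mem_preimage, Set.mem_singleton_iff, Function.mem_support,
      Finset.coe_image, Set.mem_image, Finset.mem_coe]
    constructor
    · rintro ⟨hz, hz0⟩
      have hzK : z ∈ tsupport θ := subset_tsupport _ hz0
      have : z ∈ ⋃ y ∈ hF.toFinset, V y := by
        by_contra hcon
        exact h1 ⟨z, ⟨hzK, hcon⟩, hz⟩
      obtain ⟨y, hy, hzV⟩ := Set.mem_iUnion₂.1 this
      refine ⟨⟨y, hy, ?_⟩, hz0⟩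
      rw [← hz]
      nth_rewrite 1 [he y]
      exact (e y).left_inv hzV.2
    · rintro ⟨⟨y, hy, rfl⟩, hz0⟩
      refine ⟨?_, hz0⟩
      nth_rewrite 1 [he y]
      exact (e y).right_inv (h2 y hy).2
  refine ContinuousAt.congr ?_ key
  refine tendsto_finsetSum _ fun y hy => ?_
  have hy' : S.σ y = x := by simpa using ((Set.Finite.mem_toFinset _).1 hy).1
  exact (map_continuous θ).continuousAt.comp (hcs y hy')

theorem hasCompactSupport_fiberSumFun (θ : C_c(S.U, ℂ)) :
    HasCompactSupport (S.fiberSumFun θ) := by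
  refine HasCompactSupport.intro
    (θ.hasCompactSupport.isCompact.image S.isLocalHomeomorph.continuous) fun x hx => ?_
  refine finsum_mem_eq_zero_of_forall_eq_zero fun y hy => ?_
  by_contra h
  exact hx ⟨y, subset_tsupport _ h, hy⟩

/-- The function `x ↦ ∑_{σ(y) = x} θ(y)` as an element of `C_c(X)`. -/
noncomputable def fiberSum (θ : C_c(S.U, ℂ)) : C_c(X, ℂ) where
  toFun := S.fiberSumFun θ
  continuous_toFun := S.continuous_fiberSumFun θ
  hasCompactSupport' := S.hasCompactSupport_fiberSumFun θ

/-- `⟨ξ, η⟩(x) = ∑_{σ(y) = x} conj (ξ(y)) η(y)`. -/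
noncomputable def ip (ξ η : C_c(S.U, ℂ)) : C_c(X, ℂ) := S.fiberSum (star ξ * η)

/-- The inclusion `C_c(U) ⊆ C_c(X)`, extension by zero. -/
noncomputable def extendZero (θ : C_c(S.U, ℂ)) : C_c(X, ℂ) where
  toFun := Function.extend Subtype.val θ 0
  continuous_toFun := θ.hasCompactSupport.continuous_extend_zero S.U.isOpen (map_continuous θ)
  hasCompactSupport' := θ.hasCompactSupport.extend_zero continuous_subtype_val

/-- The inclusion `C_c(X) ⊆ C₀(X)`. -/
noncomputable def toC₀ (f : C_c(X, ℂ)) : C₀(X, ℂ) := (f : C₀(X, ℂ))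

end Functions

section Algebra

variable {X : Type u} [TopologicalSpace X] [T2Space X] (S : SGDS X)

/-- A pair `(t⁰, t¹)` of a *-homomorphism `t⁰ : C₀(X) → A` and a linear map `t¹ : C_c(U) → A` into
a C*-algebra `A` that satisfies the two relations defining `C*(Σ)`. -/
structure Pair (A : Type v) [NonUnitalCStarAlgebra A] where
  t0 : C₀(X, ℂ) →⋆ₙₐ[ℂ] A
  t1 : C_c(S.U, ℂ) →ₗ[ℂ] A
  star_t1_mul_t1 : ∀ ξ η : C_c(S.U, ℂ), star (t1 ξ) * t1 η = t0 (toC₀ (S.ip ξ η))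
  t1_mul_star_t1 : ∀ V : Set S.U, IsOpen V → Set.InjOn S.σ V → ∀ ξ η : C_c(S.U, ℂ),
    tsupport ξ ⊆ V → tsupport η ⊆ V →
      t1 ξ * star (t1 η) = t0 (toC₀ (S.extendZero (ξ * star η)))

variable {S} in
theorem Pair.norm_t0_le {A : Type v} [NonUnitalCStarAlgebra A] (P : S.Pair A) (f : C₀(X, ℂ)) :
    ‖P.t0 f‖ ≤ ‖f‖ :=
  NonUnitalStarAlgHom.norm_apply_le P.t0 f

variable {S} in
theorem Pair.norm_t1_le {A : Type v} [NonUnitalCStarAlgebra A] (P : S.Pair A)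
    (ξ : C_c(S.U, ℂ)) : ‖P.t1 ξ‖ ≤ √‖toC₀ (S.ip ξ ξ)‖ := by
  refine Real.le_sqrt_of_sq_le ?_
  rw [sq, ← CStarRing.norm_star_mul_self, P.star_t1_mul_t1]
  exact P.norm_t0_le _

/-- A C*-algebra together with a pair as above. The universe of `X` is large enough: a
C*-algebra that is generated by the image of a pair has a dense subset which is a quotient of the
free algebra on `C₀(X)` and `C_c(U)`. -/
structure Target where
  carrier : Type u
  [inst : NonUnitalCStarAlgebra carrier]
  pair : S.Pair carrier

attribute [instance] Target.inst

/-- The C*-algebra `∏ A` of bounded families, over all pairs in C*-algebras `A`. -/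
abbrev Big : Type (u + 1) := lp (fun i : S.Target => i.carrier) ∞

/-- The product of the maps `t⁰` over all pairs. -/
noncomputable def bigT0 : C₀(X, ℂ) →⋆ₙₐ[ℂ] S.Big where
  toFun f := ⟨fun i => i.pair.t0 f,
    memℓp_infty ⟨‖f‖, by rintro _ ⟨i, rfl⟩; exact i.pair.norm_t0_le f⟩⟩
  map_smul' c f := by ext i; exact map_smul i.pair.t0 c f
  map_zero' := by ext i; exact map_zero i.pair.t0
  map_add' f g := by ext i; exact map_add i.pair.t0 f g
  map_mul' f g := by ext i; exact map_mul i.pair.t0 f g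
  map_star' f := by ext i; exact map_star i.pair.t0 f

/-- The product of the maps `t¹` over all pairs. -/
noncomputable def bigT1 : C_c(S.U, ℂ) →ₗ[ℂ] S.Big where
  toFun ξ := ⟨fun i => i.pair.t1 ξ,
    memℓp_infty ⟨√‖toC₀ (S.ip ξ ξ)‖, by rintro _ ⟨i, rfl⟩; exact i.pair.norm_t1_le ξ⟩⟩
  map_smul' c f := by ext i; exact map_smul i.pair.t1 c f
  map_add' f g := by ext i; exact map_add i.pair.t1 f g

/-- The universal C*-algebra generated by a pair, as a C*-subalgebra of the product of all
C*-algebras with a pair: the closed *-subalgebra generated by the images of `t⁰` and `t¹`. -/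
noncomputable def universalSubalgebra : NonUnitalStarSubalgebra ℂ S.Big :=
  (NonUnitalStarAlgebra.adjoin ℂ
    (Set.range S.bigT0 ∪ Set.range S.bigT1)).topologicalClosure

/-- The C*-algebra `C*(Σ)`. -/
abbrev CStar : Type (u + 1) := S.universalSubalgebra

instance isClosed_universalSubalgebra : IsClosed (S.universalSubalgebra : Set S.Big) :=
  NonUnitalStarSubalgebra.isClosed_topologicalClosure _

theorem bigT0_mem (f : C₀(X, ℂ)) : S.bigT0 f ∈ S.universalSubalgebra :=
  NonUnitalStarSubalgebra.le_topologicalClosure _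
    (NonUnitalStarAlgebra.subset_adjoin ℂ _ (Or.inl ⟨f, rfl⟩))

theorem bigT1_mem (ξ : C_c(S.U, ℂ)) : S.bigT1 ξ ∈ S.universalSubalgebra :=
  NonUnitalStarSubalgebra.le_topologicalClosure _
    (NonUnitalStarAlgebra.subset_adjoin ℂ _ (Or.inr ⟨ξ, rfl⟩))

/-- The universal pair `(t⁰, t¹)` of `C*(Σ)`. -/
noncomputable def universalPair : S.Pair S.CStar where
  t0 :=
    { toFun := fun f => ⟨S.bigT0 f, S.bigT0_mem f⟩
      map_smul' := fun c f => Subtype.ext (map_smul S.bigT0 c f)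
      map_zero' := Subtype.ext (map_zero S.bigT0)
      map_add' := fun f g => Subtype.ext (map_add S.bigT0 f g)
      map_mul' := fun f g => Subtype.ext (map_mul S.bigT0 f g)
      map_star' := fun f => Subtype.ext (map_star S.bigT0 f) }
  t1 :=
    { toFun := fun ξ => ⟨S.bigT1 ξ, S.bigT1_mem ξ⟩
      map_smul' := fun c ξ => Subtype.ext (map_smul S.bigT1 c ξ)
      map_add' := fun ξ η => Subtype.ext (map_add S.bigT1 ξ η) }
  star_t1_mul_t1 ξ η := by
    apply Subtype.ext
    ext i
    exact i.pair.star_t1_mul_t1 ξ η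
  t1_mul_star_t1 V hV hinj ξ η hξ hη := by
    apply Subtype.ext
    ext i
    exact i.pair.t1_mul_star_t1 V hV hinj ξ η hξ hη

/-- The *-homomorphism `C*(Σ) → A` induced by a pair in `A`. -/
def lift {A : Type u} [NonUnitalCStarAlgebra A] (P : S.Pair A) : S.CStar →⋆ₙₐ[ℂ] A where
  toFun a := (a : S.Big) (⟨A, P⟩ : S.Target)
  map_smul' _ _ := rfl
  map_zero' := rfl
  map_add' _ _ := rfl
  map_mul' _ _ := rfl
  map_star' _ := rfl

theorem lift_t0 {A : Type u} [NonUnitalCStarAlgebra A] (P : S.Pair A) (f : C₀(X, ℂ)) :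
    S.lift P (S.universalPair.t0 f) = P.t0 f := rfl

theorem lift_t1 {A : Type u} [NonUnitalCStarAlgebra A] (P : S.Pair A) (ξ : C_c(S.U, ℂ)) :
    S.lift P (S.universalPair.t1 ξ) = P.t1 ξ := rfl

/-- A *-homomorphism on `C*(Σ)` is determined by its values on the universal pair. -/
theorem lift_unique {A : Type v} [NonUnitalCStarAlgebra A] (φ ψ : S.CStar →⋆ₙₐ[ℂ] A)
    (h0 : ∀ f, φ (S.universalPair.t0 f) = ψ (S.universalPair.t0 f))
    (h1 : ∀ ξ, φ (S.universalPair.t1 ξ) = ψ (S.universalPair.t1 ξ)) : φ = ψ := by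
  have hφ : Continuous φ :=
    AddMonoidHomClass.continuous_of_bound φ 1 fun a => by
      simpa using NonUnitalStarAlgHom.norm_apply_le φ a
  have hψ : Continuous ψ :=
    AddMonoidHomClass.continuous_of_bound ψ 1 fun a => by
      simpa using NonUnitalStarAlgHom.norm_apply_le ψ a
  have key : ∀ b (hb : b ∈ NonUnitalStarAlgebra.adjoin ℂ
      (Set.range S.bigT0 ∪ Set.range S.bigT1)),
      φ ⟨b, NonUnitalStarSubalgebra.le_topologicalClosure _ hb⟩ =
        ψ ⟨b, NonUnitalStarSubalgebra.le_topologicalClosure _ hb⟩ := by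
    intro b hb
    induction hb using NonUnitalStarAlgebra.adjoin_induction with
    | mem x hx =>
      rcases hx with ⟨f, rfl⟩ | ⟨ξ, rfl⟩
      · exact h0 f
      · exact h1 ξ
    | add x y hx hy ihx ihy =>
      have := congrArg₂ (· + ·) ihx ihy
      simp only [← map_add] at this
      exact this
    | zero => exact (map_zero φ).trans (map_zero ψ).symm
    | mul x y hx hy ihx ihy =>
      have := congrArg₂ (· * ·) ihx ihy
      simp only [← map_mul] at this
      exact this
    | smul r x hx ih =>
      have := congrArg (r • ·) ih
      simp only [← map_smul] at this
      exact this
    | star x hx ih =>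
      have := congrArg star ih
      simp only [← map_star] at this
      exact this
  ext ⟨a, ha⟩
  obtain ⟨b, hb, hlim⟩ := mem_closure_iff_seq_limit.1 ha
  have hlim' : Filter.Tendsto
      (fun n => (⟨b n, NonUnitalStarSubalgebra.le_topologicalClosure _ (hb n)⟩ : S.CStar))
      Filter.atTop (nhds ⟨a, ha⟩) := tendsto_subtype_rng.2 hlim
  refine tendsto_nhds_unique ((hφ.tendsto _).comp hlim') (((hψ.tendsto _).comp hlim').congr ?_)
  intro n
  exact (key _ (hb n)).symm

end Algebra

section Representations

/-- A weighted composition operator `h ↦ (y ↦ w(y) h(τ(y)))` on `ℓ²(ι)`. -/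
noncomputable def weightedComp {ι : Type u} (w : ι → ℂ) (τ : ι → ι) (C : ℝ) (hC : 0 ≤ C)
    (hw : ∀ (s : Finset ι) (x : ι), (∀ y ∈ s, τ y = x) → ∑ y ∈ s, ‖w y‖ ^ 2 ≤ C ^ 2) :
    lp (fun _ : ι => ℂ) 2 →L[ℂ] lp (fun _ : ι => ℂ) 2 :=
  have key : ∀ (h : lp (fun _ : ι => ℂ) 2) (s : Finset ι),
      ∑ y ∈ s, ‖w y * h (τ y)‖ ^ (2 : ℝ≥0∞).toReal ≤ (C * ‖h‖) ^ (2 : ℝ≥0∞).toReal := by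
    classical
    intro h s
    have h2 := lp.sum_rpow_le_norm_rpow (p := 2) (by norm_num) h (s.image τ)
    simp only [ENNReal.toReal_ofNat, Real.rpow_ofNat] at h2 ⊢
    rw [← Finset.sum_fiberwise_of_maps_to (g := τ) (t := s.image τ)
      fun y hy => Finset.mem_image_of_mem τ hy]
    calc _ = ∑ x ∈ s.image τ, (∑ y ∈ s with τ y = x, ‖w y‖ ^ 2) * ‖h x‖ ^ 2 := by
            refine Finset.sum_congr rfl fun x _ => ?_
            rw [Finset.sum_mul]
            refine Finset.sum_congr rfl fun y hy => ?_
            rw [(Finset.mem_filter.1 hy).2, norm_mul, mul_pow]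
      _ ≤ ∑ x ∈ s.image τ, C ^ 2 * ‖h x‖ ^ 2 := by
            refine Finset.sum_le_sum fun x _ => ?_
            exact mul_le_mul_of_nonneg_right
              (hw _ x fun y hy => (Finset.mem_filter.1 hy).2) (by positivity)
      _ ≤ (C * ‖h‖) ^ 2 := by
            rw [← Finset.mul_sum, mul_pow]
            exact mul_le_mul_of_nonneg_left h2 (by positivity)
  LinearMap.mkContinuous
    { toFun := fun h => ⟨fun y => w y * h (τ y), memℓp_gen' (key h)⟩
      map_add' := fun g h => by ext y; exact mul_add _ _ _
      map_smul' := fun c h => by ext y; exact mul_left_comm _ _ _ }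
    C fun h => lp.norm_le_of_forall_sum_le (by norm_num) (by positivity) (key h)

theorem weightedComp_apply {ι : Type u} (w : ι → ℂ) (τ : ι → ι) (C : ℝ) (hC : 0 ≤ C)
    (hw : ∀ (s : Finset ι) (x : ι), (∀ y ∈ s, τ y = x) → ∑ y ∈ s, ‖w y‖ ^ 2 ≤ C ^ 2)
    (h : lp (fun _ : ι => ℂ) 2) (y : ι) :
    weightedComp w τ C hC hw h y = w y * h (τ y) := rfl

variable {X : Type u} [TopologicalSpace X] [T2Space X] (S : SGDS X)

/-- The Hilbert space `H_{x₀} = ℓ²(Orb(x₀))`. -/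
abbrev H (x₀ : X) : Type u := lp (fun _ : S.orbit x₀ => ℂ) 2

open scoped Classical in
/-- The basis vector `δ_x`. -/
noncomputable def delta (x₀ : X) (x : S.orbit x₀) : S.H x₀ := lp.single 2 x (1 : ℂ)

variable {S} in
open scoped Classical in
theorem delta_apply (x₀ : X) (x y : S.orbit x₀) :
    S.delta x₀ x y = if y = x then 1 else 0 := by
  rw [delta, lp.single_apply, Pi.single_apply]

variable {S} in
theorem inner_delta (x₀ : X) (x : S.orbit x₀) (h : S.H x₀) :
    inner ℂ (S.delta x₀ x) h = h x := by
  classical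
  rw [delta]
  have := lp.inner_single_left (𝕜 := ℂ) x (1 : ℂ) h
  simpa using this

open scoped Classical in
/-- `σ` on the part of the orbit that lies in `U`; the value elsewhere is irrelevant. -/
noncomputable def orbitMap (x₀ : X) (y : S.orbit x₀) : S.orbit x₀ :=
  if h : (y : X) ∈ S.U then ⟨S.σ ⟨y, h⟩, (map_mem_orbit_iff x₀ ⟨y, h⟩).2 y.2⟩ else y

/-- The operator `t⁰_{(x₀,γ₀)}(f)`, given by `δ_x ↦ f(x) δ_x`. -/
noncomputable def repT0 (x₀ : X) (f : C₀(X, ℂ)) : S.H x₀ →L[ℂ] S.H x₀ :=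
  weightedComp (fun y => f y) id ‖f‖ (norm_nonneg f) (by
    intro s x hs
    have h1 : s ⊆ {x} := fun y hy => by simpa using hs y hy
    calc ∑ y ∈ s, ‖f (y : X)‖ ^ 2 ≤ ∑ y ∈ {x}, ‖f (y : X)‖ ^ 2 :=
          Finset.sum_le_sum_of_subset_of_nonneg h1 fun _ _ _ => by positivity
      _ ≤ ‖f‖ ^ 2 := by
          rw [Finset.sum_singleton]
          exact pow_le_pow_left₀ (norm_nonneg _) (f.toBCF.norm_coe_le_norm x) 2)

theorem repT0_apply (x₀ : X) (f : C₀(X, ℂ)) (h : S.H x₀) (y : S.orbit x₀) :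
    S.repT0 x₀ f h y = f y * h y := rfl

theorem ip_apply (ξ η : C_c(S.U, ℂ)) (x : X) :
    S.ip ξ η x = ∑ᶠ y ∈ S.σ ⁻¹' {x}, conj (ξ y) * η y := rfl

theorem toC₀_apply (f : C_c(X, ℂ)) (x : X) : toC₀ f x = f x := rfl

theorem extendZero_of_mem (θ : C_c(S.U, ℂ)) {x : X} (hx : x ∈ S.U) :
    S.extendZero θ x = θ ⟨x, hx⟩ :=
  Subtype.val_injective.extend_apply θ 0 (⟨x, hx⟩ : S.U)

theorem extendZero_of_notMem (θ : C_c(S.U, ℂ)) {x : X} (hx : x ∉ S.U) :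
    S.extendZero θ x = 0 :=
  Function.extend_apply' _ _ _ (by rintro ⟨y, rfl⟩; exact hx y.2)

theorem extendZero_star_mul (ξ η : C_c(S.U, ℂ)) (x : X) :
    S.extendZero (star ξ * η) x = conj (S.extendZero ξ x) * S.extendZero η x := by
  by_cases hx : x ∈ S.U
  · simp only [S.extendZero_of_mem _ hx]
    rfl
  · simp [S.extendZero_of_notMem _ hx]

theorem orbitMap_of_mem (x₀ : X) (y : S.orbit x₀) (hy : (y : X) ∈ S.U) :
    (S.orbitMap x₀ y : X) = S.σ ⟨y, hy⟩ := by
  simp [orbitMap, hy]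

open scoped Classical in
theorem finite_support_fiber (x₀ : X) (θ : C_c(S.U, ℂ)) (x : S.orbit x₀) :
    (Function.support fun y : S.orbit x₀ =>
      if S.orbitMap x₀ y = x then S.extendZero θ y else 0).Finite := by
  have h := ((S.finite_fiber_inter θ x).image Subtype.val).preimage
    (Subtype.val_injective (p := fun y => y ∈ S.orbit x₀)).injOn
  refine h.subset fun y hy => ?_
  simp only [Function.mem_support, ne_eq, ite_eq_right_iff, Classical.not_imp] at hy
  have hyU : (y : X) ∈ S.U := by
    by_contra hcon
    exact hy.2 (S.extendZero_of_notMem θ hcon)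
  refine ⟨⟨y, hyU⟩, ⟨?_, ?_⟩, rfl⟩
  · have := congrArg Subtype.val hy.1
    rwa [S.orbitMap_of_mem x₀ y hyU] at this
  · refine subset_tsupport _ ?_
    rw [Function.mem_support, ← S.extendZero_of_mem θ hyU]
    exact hy.2

open scoped Classical in
theorem tsum_fiber (x₀ : X) (θ : C_c(S.U, ℂ)) (x : S.orbit x₀) :
    ∑' y : S.orbit x₀, (if S.orbitMap x₀ y = x then S.extendZero θ y else 0) =
      S.fiberSum θ x := by
  have hmem : ∀ y : S.σ ⁻¹' {(x : X)}, ((y : S.U) : X) ∈ S.orbit x₀ := fun y =>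
    (map_mem_orbit_iff x₀ y.1).1 (by rw [show S.σ y.1 = x from y.2]; exact x.2)
  let j : S.σ ⁻¹' {(x : X)} → S.orbit x₀ := fun y => ⟨y.1, hmem y⟩
  have hj : Function.Injective j := fun y y' h =>
    Subtype.ext (Subtype.ext (congrArg (fun z : S.orbit x₀ => (z : X)) h))
  have hjx : ∀ y, S.orbitMap x₀ (j y) = x := fun y =>
    Subtype.ext ((S.orbitMap_of_mem x₀ (j y) y.1.2).trans y.2)
  have hjθ : ∀ y, S.extendZero θ (j y) = θ y.1 := fun y => S.extendZero_of_mem θ y.1.2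
  have hfin := S.finite_support_fiber x₀ θ x
  rw [← hj.tsum_eq]
  · simp only [hjx, hjθ, if_true]
    rw [tsum_eq_finsum]
    · exact finsum_set_coe_eq_finsum_mem (f := fun y => θ y) (S.σ ⁻¹' {(x : X)})
    · refine (hfin.preimage hj.injOn).subset fun y hy => ?_
      simpa [hjx, hjθ] using hy
  · intro y hy
    simp only [Function.mem_support, ne_eq, ite_eq_right_iff, Classical.not_imp] at hy
    have hyU : (y : X) ∈ S.U := by
      by_contra hcon
      exact hy.2 (S.extendZero_of_notMem θ hcon)
    refine ⟨⟨⟨y, hyU⟩, ?_⟩, rfl⟩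
    have := congrArg Subtype.val hy.1
    rwa [S.orbitMap_of_mem x₀ y hyU] at this

theorem sum_sq_extendZero_le (x₀ : X) (ξ : C_c(S.U, ℂ)) (s : Finset (S.orbit x₀))
    (x : S.orbit x₀) (hs : ∀ y ∈ s, S.orbitMap x₀ y = x) :
    ∑ y ∈ s, ‖S.extendZero ξ y‖ ^ 2 ≤ (√‖toC₀ (S.ip ξ ξ)‖) ^ 2 := by
  classical
  rw [Real.sq_sqrt (norm_nonneg _)]
  let g : S.orbit x₀ → ℝ := fun y => if S.orbitMap x₀ y = x then ‖S.extendZero ξ y‖ ^ 2 else 0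
  have hg : ∀ y, ((g y : ℝ) : ℂ) =
      if S.orbitMap x₀ y = x then S.extendZero (star ξ * ξ) y else 0 := by
    intro y
    simp only [g]
    split_ifs
    · rw [S.extendZero_star_mul, Complex.conj_mul']
      push_cast
      rfl
    · rfl
  have hsupp : (Function.support g).Finite := by
    refine (S.finite_support_fiber x₀ (star ξ * ξ) x).subset fun y hy => ?_
    rw [Function.mem_support, ← hg]
    exact_mod_cast hy
  have hg0 : ∀ y, 0 ≤ g y := fun y => by
    simp only [g]
    split_ifs <;> positivity
  have hsum : Summable g := summable_of_hasFiniteSupport hsupp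
  calc ∑ y ∈ s, ‖S.extendZero ξ y‖ ^ 2 = ∑ y ∈ s, g y :=
        Finset.sum_congr rfl fun y hy => by simp [g, hs y hy]
    _ ≤ ∑' y, g y := hsum.sum_le_tsum _ fun y _ => hg0 y
    _ ≤ ‖((∑' y, g y : ℝ) : ℂ)‖ := by
        rw [Complex.norm_real]
        exact le_abs_self _
    _ = ‖toC₀ (S.ip ξ ξ) x‖ := by
        rw [Complex.ofReal_tsum, tsum_congr hg, S.tsum_fiber]
        rfl
    _ ≤ ‖toC₀ (S.ip ξ ξ)‖ := (toC₀ (S.ip ξ ξ)).toBCF.norm_coe_le_norm x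

/-- The operator `t¹_{(x₀,γ₀)}(ξ)`, given by `δ_x ↦ γ₀ ∑_{σ(y) = x} ξ(y) δ_y`: the coefficient at
`δ_y` of the image of `h` is `γ₀ ξ(y) h(σ(y))` if `y ∈ U`, and `0` otherwise. -/
noncomputable def repT1 (x₀ : X) (γ₀ : Circle) (ξ : C_c(S.U, ℂ)) : S.H x₀ →L[ℂ] S.H x₀ :=
  weightedComp (fun y => γ₀ * S.extendZero ξ y) (S.orbitMap x₀)
    (√‖toC₀ (S.ip ξ ξ)‖) (Real.sqrt_nonneg _) (by
      intro s x hs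
      simpa only [norm_mul, Circle.norm_coe, one_mul] using S.sum_sq_extendZero_le x₀ ξ s x hs)

theorem repT1_apply (x₀ : X) (γ₀ : Circle) (ξ : C_c(S.U, ℂ)) (h : S.H x₀) (y : S.orbit x₀) :
    S.repT1 x₀ γ₀ ξ h y = γ₀ * S.extendZero ξ y * h (S.orbitMap x₀ y) := rfl

theorem star_apply_eq_inner (x₀ : X) (T : S.H x₀ →L[ℂ] S.H x₀) (h : S.H x₀) (x : S.orbit x₀) :
    (star T) h x = inner ℂ (T (S.delta x₀ x)) h := by
  rw [← inner_delta, ContinuousLinearMap.star_eq_adjoint, ContinuousLinearMap.adjoint_inner_right]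

theorem star_repT1_mul_repT1 (x₀ : X) (γ₀ : Circle) (ξ η : C_c(S.U, ℂ)) :
    star (S.repT1 x₀ γ₀ ξ) * S.repT1 x₀ γ₀ η = S.repT0 x₀ (toC₀ (S.ip ξ η)) := by
  classical
  ext h x
  rw [mul_apply_eq_comp, S.star_apply_eq_inner, lp.inner_eq_tsum, S.repT0_apply]
  have hγ : conj (γ₀ : ℂ) * γ₀ = 1 := by
    rw [← Circle.coe_inv_eq_conj, ← Circle.coe_mul, inv_mul_cancel, Circle.coe_one]
  have : ∀ y : S.orbit x₀, inner ℂ (S.repT1 x₀ γ₀ ξ (S.delta x₀ x) y) (S.repT1 x₀ γ₀ η h y) =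
      (if S.orbitMap x₀ y = x then S.extendZero (star ξ * η) y else 0) * h x := by
    intro y
    rw [S.repT1_apply, S.repT1_apply, delta_apply, S.extendZero_star_mul, RCLike.inner_apply]
    split_ifs with hy
    · rw [hy]
      simp only [map_mul, map_one]
      linear_combination (conj (S.extendZero ξ y) * S.extendZero η y * h x) * hγ
    · simp
  rw [tsum_congr this, tsum_mul_right, S.tsum_fiber]
  rfl

theorem repT1_mul_star_repT1 (x₀ : X) (γ₀ : Circle) (V : Set S.U) (hV : Set.InjOn S.σ V)
    (ξ η : C_c(S.U, ℂ)) (hξ : tsupport ξ ⊆ V) (hη : tsupport η ⊆ V) :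
    S.repT1 x₀ γ₀ ξ * star (S.repT1 x₀ γ₀ η) =
      S.repT0 x₀ (toC₀ (S.extendZero (ξ * star η))) := by
  classical
  ext h y
  rw [mul_apply_eq_comp, S.repT1_apply, S.star_apply_eq_inner, lp.inner_eq_tsum,
    S.repT0_apply, toC₀_apply, mul_comm ξ, S.extendZero_star_mul]
  have hsupp : ∀ (θ : C_c(S.U, ℂ)), tsupport θ ⊆ V → ∀ z : X, S.extendZero θ z ≠ 0 →
      ∃ hz : z ∈ S.U, (⟨z, hz⟩ : S.U) ∈ V := by
    intro θ hθ z hz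
    have hzU : z ∈ S.U := by
      by_contra hcon
      exact hz (S.extendZero_of_notMem θ hcon)
    refine ⟨hzU, hθ (subset_tsupport _ ?_)⟩
    rwa [Function.mem_support, ← S.extendZero_of_mem θ hzU]
  by_cases hy0 : S.extendZero ξ y = 0
  · simp [hy0]
  obtain ⟨hyU, hyV⟩ := hsupp ξ hξ y hy0
  have hγ : conj (γ₀ : ℂ) * γ₀ = 1 := by
    rw [← Circle.coe_inv_eq_conj, ← Circle.coe_mul, inv_mul_cancel, Circle.coe_one]
  rw [tsum_eq_single y]
  · rw [S.repT1_apply, delta_apply, if_pos rfl, RCLike.inner_apply]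
    simp only [map_mul, map_one]
    linear_combination (conj (S.extendZero η y) * S.extendZero ξ y * h y) * hγ
  · intro z hzy
    rw [S.repT1_apply, delta_apply]
    by_cases hz0 : S.extendZero η z = 0
    · simp [hz0]
    obtain ⟨hzU, hzV⟩ := hsupp η hη z hz0
    rw [if_neg, mul_zero, inner_zero_left]
    intro hcon
    apply hzy
    have h1 := congrArg Subtype.val hcon
    rw [S.orbitMap_of_mem x₀ z hzU, S.orbitMap_of_mem x₀ y hyU] at h1
    exact Subtype.ext (congrArg (fun z : S.U => (z : X)) (hV hzV hyV h1))

theorem extendZero_add (ξ η : C_c(S.U, ℂ)) (x : X) :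
    S.extendZero (ξ + η) x = S.extendZero ξ x + S.extendZero η x := by
  by_cases hx : x ∈ S.U
  · simp [S.extendZero_of_mem _ hx]
  · simp [S.extendZero_of_notMem _ hx]

theorem extendZero_smul (c : ℂ) (ξ : C_c(S.U, ℂ)) (x : X) :
    S.extendZero (c • ξ) x = c * S.extendZero ξ x := by
  by_cases hx : x ∈ S.U
  · simp [S.extendZero_of_mem _ hx]
  · simp [S.extendZero_of_notMem _ hx]

/-- The pair `(t⁰_{(x₀,γ₀)}, t¹_{(x₀,γ₀)})` in `B(H_{x₀})`. -/
noncomputable def repPair (x₀ : X) (γ₀ : Circle) : S.Pair (S.H x₀ →L[ℂ] S.H x₀) where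
  t0 :=
    { toFun := S.repT0 x₀
      map_smul' := fun c f => by ext h y; exact mul_assoc _ _ _
      map_zero' := by ext h y; exact zero_mul _
      map_add' := fun f g => by ext h y; exact add_mul _ _ _
      map_mul' := fun f g => by ext h y; exact mul_assoc _ _ _
      map_star' := fun f => by
        classical
        ext h x
        rw [S.star_apply_eq_inner, lp.inner_eq_tsum, tsum_eq_single x]
        · rw [S.repT0_apply, S.repT0_apply, delta_apply, if_pos rfl, RCLike.inner_apply, mul_one,
            mul_comm]
          rfl
        · intro z hz
          rw [S.repT0_apply, delta_apply, if_neg hz, mul_zero, inner_zero_left] }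
  t1 :=
    { toFun := S.repT1 x₀ γ₀
      map_smul' := fun c ξ => by
        ext h y
        have : (c • S.repT1 x₀ γ₀ ξ) h y = c * (S.repT1 x₀ γ₀ ξ h y) := rfl
        rw [RingHom.id_apply, this, S.repT1_apply, S.repT1_apply, S.extendZero_smul]
        ring
      map_add' := fun ξ η => by
        ext h y
        have : (S.repT1 x₀ γ₀ ξ + S.repT1 x₀ γ₀ η) h y =
          S.repT1 x₀ γ₀ ξ h y + S.repT1 x₀ γ₀ η h y := rfl
        rw [this, S.repT1_apply, S.repT1_apply, S.repT1_apply, S.extendZero_add]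
        ring }
  star_t1_mul_t1 := S.star_repT1_mul_repT1 x₀ γ₀
  t1_mul_star_t1 V _ hinj ξ η hξ hη := S.repT1_mul_star_repT1 x₀ γ₀ V hinj ξ η hξ hη

/-- The representation `π_{(x₀,γ₀)} : C*(Σ) → B(H_{x₀})`. -/
noncomputable def rep (x₀ : X) (γ₀ : Circle) : S.CStar →⋆ₙₐ[ℂ] (S.H x₀ →L[ℂ] S.H x₀) :=
  S.lift (S.repPair x₀ γ₀)

theorem rep_t0_delta (x₀ : X) (γ₀ : Circle) (f : C₀(X, ℂ)) (x : S.orbit x₀) :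
    S.rep x₀ γ₀ (S.universalPair.t0 f) (S.delta x₀ x) = f x • S.delta x₀ x := by
  classical
  ext y
  change f y * S.delta x₀ x y = f x * S.delta x₀ x y
  rw [delta_apply]
  split_ifs with h
  · rw [h]
  · simp

open scoped Classical in
theorem rep_t1_delta (x₀ : X) (γ₀ : Circle) (ξ : C_c(S.U, ℂ)) (x y : S.orbit x₀) :
    S.rep x₀ γ₀ (S.universalPair.t1 ξ) (S.delta x₀ x) y =
      if h : (y : X) ∈ S.U then (if S.σ ⟨y, h⟩ = x then γ₀ * ξ ⟨y, h⟩ else 0) else 0 := by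
  change S.repT1 x₀ γ₀ ξ (S.delta x₀ x) y = _
  rw [S.repT1_apply, delta_apply]
  split_ifs <;>
    simp_all [S.extendZero_of_mem, S.extendZero_of_notMem, Subtype.ext_iff, S.orbitMap_of_mem]

end Representations

section Ideals

variable {X : Type u} [TopologicalSpace X] [T2Space X] (S : SGDS X)

/-- The ideal `P_{(x,γ)} = ker π_{(x,γ)}` of `C*(Σ)`. -/
noncomputable def P (x : X) (γ : Circle) : TwoSidedIdeal S.CStar := TwoSidedIdeal.ker (S.rep x γ)

/-- `I_Y`, the intersection of the `P_{(x,γ)}` over `(x,γ) ∈ Y`. -/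
noncomputable def idealOf (Y : Set (X × Circle)) : TwoSidedIdeal S.CStar :=
  ⨅ p : Y, S.P p.1.1 p.1.2

/-- `Y_I`, the set of all `(x,γ)` with `I ⊆ P_{(x,γ)}`. -/
def subsetOf (I : TwoSidedIdeal S.CStar) : Set (X × Circle) :=
  {p | I ≤ S.P p.1 p.2}

/-- The ideals `I_Y` are closed, as ideals of a C*-algebra are understood to be. -/
theorem isClosed_idealOf (Y : Set (X × Circle)) : IsClosed {a : S.CStar | a ∈ S.idealOf Y} := by
  have h : {a : S.CStar | a ∈ S.idealOf Y} = ⋂ p : Y, {a | S.rep p.1.1 p.1.2 a = 0} := by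
    ext a
    simp only [idealOf, P, Set.mem_ofPred_eq, TwoSidedIdeal.mem_iInf, Set.mem_iInter,
      TwoSidedIdeal.mem_ker]
  rw [h]
  refine isClosed_iInter fun p => isClosed_eq ?_ continuous_const
  exact AddMonoidHomClass.continuous_of_bound (S.rep p.1.1 p.1.2) 1 fun a => by
    simpa using NonUnitalStarAlgHom.norm_apply_le (S.rep p.1.1 p.1.2) a

/-- The fibre `Y_x = {γ | (x,γ) ∈ Y}`. -/
def fiber (Y : Set (X × Circle)) (x : X) : Set Circle := {γ | (x, γ) ∈ Y}

/-- The root of unity `ζ_n = e^{2πi/n}`. -/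
noncomputable def zeta (n : ℕ) : Circle := Circle.exp (2 * Real.pi / n)

/-- Admissible subsets of `X × 𝕋`. -/
structure IsAdmissible (Y : Set (X × Circle)) : Prop where
  isClosed : IsClosed Y
  fiber_eq : ∀ x : S.U, fiber Y x = fiber Y (S.σ x)
  of_ne : ∀ x₀ : X, fiber Y x₀ ≠ ∅ → fiber Y x₀ ≠ Set.univ →
    S.IsPeriodic x₀ ∧
    (fun γ => zeta (S.period x₀).toNat * γ) '' fiber Y x₀ = fiber Y x₀ ∧
    ∃ V ∈ nhds x₀, ∀ x ∈ V, S.preperiod x ≠ S.preperiod x₀ → fiber Y x = ∅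

end Ideals

end SGDS

/-!
The inclusion `Y ⊆ Y_{I_Y}` is formal. For the other one, let `(x₀, γ₀) ∉ Y`; the task is to
separate the representation `π_{(x₀,γ₀)}` from the representations `π_{(x,γ)}` with `(x, γ) ∈ Y`.

If `Y_{x₀}` is empty, then `x₀` does not lie in the projection of `Y` to `X`, which is closed, since
`𝕋` is compact, and a union of orbits. An element `t⁰(f)` with `f(x₀) = 1` and `f = 0` on that
projection does it (`SGDS.IsAdmissible.notMem_of_fiber_eq_empty`).

Otherwise `x₀` is periodic, and its orbit contains a point `x₁` on a cycle, of period `p`, say.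
Choose `ξ ∈ C_c(U)` which is `1` near the cycle, and consider
`b = (t⁰(f) + γ₀⁻ᵖ t⁰(f) t¹(ξ)ᵖ) / 2`, where `f` is a bump function at `x₁` with a small support.
* The diagonal coefficient of `π_{(x₀,γ₀)}(b)` at `δ_{x₁}` is `1`, hence `‖π_{(x₀,γ₀)}(b)‖ ≥ 1`
  (`SGDS.one_le_norm_repT0_mul_one_add`).
* Let `(x, γ) ∈ Y`. If `Orb(x)` misses the support of `f`, then `π_{(x,γ)}(b) = 0`. Otherwise, by
  admissibility, the points of `Orb(x)` in that support lie on a cycle, whose length `n` is the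
  period of `x`. So `π_{(x,γ)}(b)` is a diagonal contraction times `(1 + γ₀⁻ᵖ vᵖ) / 2`, where `v` is
  `γ` times a permutation operator with `n`-th power `1`. The spectrum of `v` consists of `n`-th
  roots of `γⁿ`, and these belong to `Y_x` because `Y_x` is invariant under `ζ_n`. Since `γ₀ᵖ` is
  not a `p`-th power of an element of `Y_{x₁}`, and `Y` is closed, there is one `r < 1` with
  `|1 + γ₀⁻ᵖ γ'ᵖ| / 2 ≤ r` for all `γ'` in the fibres of `Y` over a neighbourhood of `x₁`, and one of
  these fibres equals `Y_x`. It follows that `‖π_{(x,γ)}(b)‖ ≤ r`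
  (`SGDS.norm_repT0_mul_one_add_le`).

If `I_Y` were contained in `P_{(x₀,γ₀)}`, then `‖π_{(x₀,γ₀)}(b)‖` would be at most the supremum of
`‖π_{(x,γ)}(b)‖` over `Y` (`NonUnitalStarAlgHom.norm_apply_le_of_forall_norm_le`), a contradiction.
-/

/-! ### Norms in C*-algebras -/

section CStarNorm

theorem NonUnitalStarAlgHom.continuous_of_cstar {A B : Type*} [NonUnitalCStarAlgebra A]
    [NonUnitalCStarAlgebra B] (φ : A →⋆ₙₐ[ℂ] B) : Continuous φ :=
  AddMonoidHomClass.continuous_of_bound φ 1 fun a => by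
    simpa using NonUnitalStarAlgHom.norm_apply_le φ a

/-- If the common kernel of a family of *-homomorphisms between C*-algebras is contained in the
kernel of `ψ`, then `‖ψ a‖` is bounded by the supremum of the norms of the images of `a` under the
family. This is the fact that an injective *-homomorphism is isometric, obtained here from the
functional calculus without passing to a quotient. -/
theorem NonUnitalStarAlgHom.norm_apply_le_of_forall_norm_le {ι A C : Type*} {B : ι → Type*}
    [NonUnitalCStarAlgebra A] [∀ i, NonUnitalCStarAlgebra (B i)] [NonUnitalCStarAlgebra C]
    (φ : ∀ i, A →⋆ₙₐ[ℂ] B i) (ψ : A →⋆ₙₐ[ℂ] C) (h : ∀ a, (∀ i, φ i a = 0) → ψ a = 0)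
    {a : A} {M : ℝ} (hM : 0 ≤ M) (ha : ∀ i, ‖φ i a‖ ≤ M) : ‖ψ a‖ ≤ M := by
  -- `g` vanishes exactly on `[-M², M²]`, so that `g (a⋆ a)` is killed by every `φ i`, hence by `ψ`.
  let g : ℝ → ℝ := fun t => max (|t| - M ^ 2) 0
  have hg : Continuous g := by fun_prop
  have hg0 : g 0 = 0 := by simp [g, sq_nonneg]
  have hb : IsSelfAdjoint (star a * a) := .star_mul_self a
  have hφ : ∀ i, φ i (cfcₙ g (star a * a)) = 0 := by
    intro i
    have hbi : IsSelfAdjoint (φ i (star a * a)) := hb.map (φ i)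
    rw [(φ i).map_cfcₙ g (star a * a) hg.continuousOn hg0
      (φ i).continuous_of_cstar hb hbi]
    rw [← norm_le_zero_iff]
    refine norm_cfcₙ_le fun t ht => ?_
    have h1 :=
      NonUnitalIsometricContinuousFunctionalCalculus.norm_quasispectrum_le (𝕜 := ℝ) _ ht hbi
    rw [map_mul, map_star, CStarRing.norm_star_mul_self, ← sq] at h1
    have h2 : |t| ≤ M ^ 2 := h1.trans (pow_le_pow_left₀ (norm_nonneg _) (ha i) 2)
    simp [g, h2]
  have hψ := h _ hφ
  have hbψ : IsSelfAdjoint (ψ (star a * a)) := hb.map ψ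
  rw [ψ.map_cfcₙ g (star a * a) hg.continuousOn hg0
      ψ.continuous_of_cstar hb hbψ] at hψ
  have h3 : ‖ψ (star a * a)‖ ≤ M ^ 2 := by
    nth_rewrite 1 [← cfcₙ_id ℝ (ψ (star a * a)) hbψ]
    refine norm_cfcₙ_le fun t ht => ?_
    have h4 := norm_apply_le_norm_cfcₙ g (ψ (star a * a)) ht hg.continuousOn hg0 hbψ
    rw [hψ, norm_zero, norm_le_zero_iff] at h4
    have h5 : |t| - M ^ 2 ≤ 0 := by simpa [g] using h4
    rw [id, Real.norm_eq_abs]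
    linarith
  rw [map_mul, map_star, CStarRing.norm_star_mul_self, ← sq] at h3
  exact le_of_sq_le_sq h3 hM

open Polynomial in
/-- A normal element `v` with `v ^ n = w` has its spectrum among the `n`-th roots of `w`, which
bounds the norm of a polynomial in `v`. -/
theorem norm_aeval_le_of_pow_eq {A : Type*} [CStarAlgebra A] {v : A} (hv : IsStarNormal v)
    {n : ℕ} {w : ℂ} (hvn : v ^ n = algebraMap ℂ A w) (q : ℂ[X]) {M : ℝ} (hM : 0 ≤ M)
    (hq : ∀ z : ℂ, z ^ n = w → ‖q.eval z‖ ≤ M) : ‖aeval v q‖ ≤ M := by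
  rcases subsingleton_or_nontrivial A with hA | hA
  · rw [Subsingleton.elim (aeval v q) 0, norm_zero]
    exact hM
  rw [← cfc_polynomial (R := ℂ) q v hv]
  refine norm_cfc_le hM fun z hz => hq z ?_
  have h1 := spectrum.pow_mem_pow v n hz
  rw [hvn, spectrum.scalar_eq] at h1
  exact h1

end CStarNorm

namespace SGDS

/-! ### Permutation operators on `ℓ²` -/

section WeightedComp

variable {ι : Type u}

theorem sum_const_le_of_injective (w : ℂ) (τ : ι ≃ ι) (s : Finset ι) (x : ι)
    (h : ∀ y ∈ s, τ y = x) :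
    ∑ _y ∈ s, ‖w‖ ^ 2 ≤ ‖w‖ ^ 2 := by
  have h1 : s ⊆ {τ.symm x} := fun y hy => by
    rw [Finset.mem_singleton, Equiv.eq_symm_apply]
    exact h y hy
  calc ∑ _y ∈ s, ‖w‖ ^ 2 ≤ ∑ _y ∈ {τ.symm x}, ‖w‖ ^ 2 :=
        Finset.sum_le_sum_of_subset_of_nonneg h1 fun _ _ _ => by positivity
    _ = ‖w‖ ^ 2 := by simp

/-- The operator `h ↦ w • (h ∘ τ)` on `ℓ²(ι)` for a permutation `τ` of `ι`. -/
noncomputable def permOp (w : ℂ) (τ : ι ≃ ι) :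
    lp (fun _ : ι => ℂ) 2 →L[ℂ] lp (fun _ : ι => ℂ) 2 :=
  weightedComp (fun _ => w) τ ‖w‖ (norm_nonneg w) (sum_const_le_of_injective w τ)

theorem permOp_apply (w : ℂ) (τ : ι ≃ ι) (h : lp (fun _ : ι => ℂ) 2) (y : ι) :
    permOp w τ h y = w * h (τ y) := rfl

theorem star_permOp (w : ℂ) (τ : ι ≃ ι) : star (permOp w τ) = permOp (conj w) τ.symm := by
  rw [ContinuousLinearMap.star_eq_adjoint]
  refine ((ContinuousLinearMap.eq_adjoint_iff _ _).2 fun g h => ?_).symm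
  rw [lp.inner_eq_tsum, lp.inner_eq_tsum, ← τ.tsum_eq]
  refine tsum_congr fun y => ?_
  rw [permOp_apply, permOp_apply, RCLike.inner_apply, RCLike.inner_apply, τ.symm_apply_apply]
  simp only [map_mul, Complex.conj_conj]
  ring

theorem isStarNormal_permOp (w : ℂ) (τ : ι ≃ ι) : IsStarNormal (permOp w τ) := by
  refine ⟨?_⟩
  rw [star_permOp]
  ext h y
  rw [mul_apply_eq_comp, mul_apply_eq_comp, permOp_apply, permOp_apply,
    permOp_apply, permOp_apply, τ.symm_apply_apply, τ.apply_symm_apply]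
  ring

theorem permOp_pow_apply (w : ℂ) (τ : ι ≃ ι) (n : ℕ) (h : lp (fun _ : ι => ℂ) 2) (y : ι) :
    (permOp w τ ^ n) h y = w ^ n * h (τ^[n] y) := by
  induction n generalizing y with
  | zero => simp
  | succ n ih =>
    rw [pow_succ', mul_apply_eq_comp, permOp_apply, ih, Function.iterate_succ_apply]
    ring

end WeightedComp

/-! ### Iterates, periods and orbits -/

section Dynamics

variable {X : Type u} [TopologicalSpace X] {S : SGDS X}

theorem iter_add (m n : ℕ) (x : X) : S.iter (m + n) x = (S.iter m x).bind (S.iter n) := by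
  induction n with
  | zero => exact (Option.bind_fun_some _).symm
  | succ n ih =>
    have h : S.iter (n + 1) = fun x => (S.iter n x).bind S.step := rfl
    rw [← add_assoc, iter, ih, h, Option.bind_assoc]

theorem iter_add_of_eq {m : ℕ} {x y : X} (h : S.iter m x = some y) (n : ℕ) :
    S.iter (m + n) x = S.iter n y := by
  rw [iter_add, h, Option.bind_some]

theorem mem_U_of_step_eq {x y : X} (h : S.step x = some y) :
    ∃ hx : x ∈ S.U, S.σ ⟨x, hx⟩ = y := by
  unfold step at h
  split_ifs at h with hx
  exact ⟨hx, Option.some.inj h⟩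

theorem iter_mul_self {n : ℕ} {x : X} (h : S.iter n x = some x) (k : ℕ) :
    S.iter (n * k) x = some x := by
  induction k with
  | zero => rfl
  | succ k ih => rw [mul_add, mul_one, iter_add_of_eq ih, h]

theorem exists_iter_eq_of_le {m n : ℕ} (hmn : m ≤ n) {x z : X} (h : S.iter n x = some z) :
    ∃ y, S.iter m x = some y := by
  obtain ⟨k, rfl⟩ := Nat.exists_eq_add_of_le hmn
  rw [iter_add] at h
  obtain ⟨y, hy, -⟩ := Option.bind_eq_some_iff.1 h
  exact ⟨y, hy⟩

theorem exists_iter_eq_of_iter_eq_self {n : ℕ} (hn : 1 ≤ n) {x : X} (h : S.iter n x = some x)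
    (k : ℕ) : ∃ y, S.iter k x = some y :=
  exists_iter_eq_of_le (Nat.le_mul_of_pos_left k hn) (iter_mul_self h k)

theorem iter_eq_self_of_iter_eq {n j : ℕ} {x y : X} (h : S.iter n x = some x)
    (hxy : S.iter j x = some y) : S.iter n y = some y := by
  rw [← iter_add_of_eq hxy, add_comm, iter_add_of_eq h, hxy]

theorem exists_iterEq_add_iff (n : ℕ) (x : X) :
    (∃ k, S.IterEq (k + n) x k x) ↔ ∃ k y, S.iter k x = some y ∧ S.iter n y = some y := by
  constructor
  · rintro ⟨k, y, h₁, h₂⟩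
    exact ⟨k, y, h₂, by rwa [iter_add_of_eq h₂] at h₁⟩
  · rintro ⟨k, y, h₁, h₂⟩
    exact ⟨k, y, by rwa [iter_add_of_eq h₁], h₁⟩

/-- A point and its iterates have the same period: the condition `1 ≤ n` in the definition of the
period makes all iterates of a periodic point defined. -/
theorem period_eq_of_iter_eq {j : ℕ} {x w : X} (h : S.iter j x = some w) :
    S.period x = S.period w := by
  unfold period
  congr 1
  ext p
  refine exists_congr fun n => and_congr_right fun _ => and_congr_right fun hn => ?_
  rw [exists_iterEq_add_iff, exists_iterEq_add_iff]
  constructor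
  · rintro ⟨k, y, h₁, h₂⟩
    obtain ⟨z, hz⟩ := exists_iter_eq_of_iter_eq_self hn h₂ j
    refine ⟨k, z, ?_, iter_eq_self_of_iter_eq h₂ hz⟩
    rw [← iter_add_of_eq h, add_comm, iter_add_of_eq h₁, hz]
  · rintro ⟨k, y, h₁, h₂⟩
    exact ⟨j + k, y, by rwa [iter_add_of_eq h], h₂⟩

theorem period_eq_of_mem_orbit {x₀ x : X} (h : x ∈ S.orbit x₀) : S.period x = S.period x₀ := by
  obtain ⟨n, m, y, h₁, h₂⟩ := h
  rw [period_eq_of_iter_eq h₁, period_eq_of_iter_eq h₂]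

theorem exists_iter_eq_of_period_eq {n : ℕ} {x : X} (h : S.period x = n) :
    1 ≤ n ∧ ∃ k y, S.iter k x = some y ∧ S.iter n y = some y := by
  have hne : {p : ℕ∞ | ∃ n : ℕ, p = n ∧ 1 ≤ n ∧ ∃ k, S.IterEq (k + n) x k x}.Nonempty := by
    by_contra hcon
    rw [Set.not_nonempty_iff_eq_empty] at hcon
    rw [period, hcon, sInf_empty] at h
    exact ENat.top_ne_natCast n h
  obtain ⟨m, hm, hm1, hk⟩ := csInf_mem hne
  change S.period x = m at hm
  obtain rfl : m = n := by exact_mod_cast hm.symm.trans h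
  exact ⟨hm1, (exists_iterEq_add_iff m x).1 hk⟩

/-- A point that some positive iterate of `σ` fixes is fixed by the iterate of order its period. -/
theorem exists_period_eq_of_iter_eq_self {n : ℕ} (hn : 1 ≤ n) {x : X} (h : S.iter n x = some x) :
    ∃ p : ℕ, S.period x = p ∧ 1 ≤ p ∧ S.iter p x = some x := by
  have hle : S.period x ≤ n := sInf_le ⟨n, rfl, hn, 0, x, by rwa [zero_add], rfl⟩
  obtain ⟨p, hp⟩ := ENat.ne_top_iff_exists.1 (ne_top_of_le_ne_top (ENat.natCast_ne_top n) hle)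
  obtain ⟨hp1, k, y, h₁, h₂⟩ := exists_iter_eq_of_period_eq hp.symm
  refine ⟨p, hp.symm, hp1, ?_⟩
  obtain ⟨j, hj⟩ := Nat.exists_eq_add_of_le (Nat.le_mul_of_pos_left k hn)
  refine iter_eq_self_of_iter_eq (j := j) h₂ ?_
  rw [← iter_add_of_eq h₁, ← hj, iter_mul_self h]

theorem preperiod_eq_zero_of_iter_eq_self {n : ℕ} (hn : 1 ≤ n) {x : X}
    (h : S.iter n x = some x) : S.preperiod x = 0 := by
  obtain ⟨p, hp, -, hpx⟩ := exists_period_eq_of_iter_eq_self hn h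
  exact nonpos_iff_eq_zero.1 (sInf_le ⟨0, p, rfl, hp, x, by rwa [zero_add], rfl⟩)

theorem exists_iter_eq_self_of_preperiod_eq_zero {x : X} (h : S.preperiod x = 0) :
    ∃ n : ℕ, S.period x = n ∧ S.iter n x = some x := by
  have hne : {l : ℕ∞ | ∃ k n : ℕ, l = k ∧ S.period x = n ∧ S.IterEq (k + n) x k x}.Nonempty := by
    by_contra hcon
    rw [Set.not_nonempty_iff_eq_empty] at hcon
    rw [preperiod, hcon, sInf_empty] at h
    exact ENat.top_ne_zero h
  obtain ⟨k, n, hk, hn, y, h₁, h₂⟩ := csInf_mem hne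
  change S.preperiod x = k at hk
  obtain rfl : k = 0 := by exact_mod_cast hk.symm.trans h
  obtain rfl : x = y := Option.some.inj h₂
  exact ⟨n, hn, by rwa [zero_add] at h₁⟩

/-- The iterates of `σ` have open domains and are continuous there. -/
theorem eventually_iter {k : ℕ} {x z : X} (h : S.iter k x = some z) {O : Set X} (hO : O ∈ nhds z) :
    ∀ᶠ y in nhds x, ∃ w ∈ O, S.iter k y = some w := by
  induction k generalizing z O with
  | zero =>
    obtain rfl : x = z := Option.some.inj h
    exact Filter.mem_of_superset hO fun y hy => ⟨y, hy, rfl⟩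
  | succ k ih =>
    obtain ⟨w, hw, hwz⟩ := Option.bind_eq_some_iff.1 h
    obtain ⟨hwU, rfl⟩ := mem_U_of_step_eq hwz
    have hO' : Subtype.val '' (S.σ ⁻¹' O) ∈ nhds w :=
      S.U.isOpen.isOpenEmbedding_subtypeVal.isOpenMap.image_mem_nhds (x := ⟨w, hwU⟩)
        (S.isLocalHomeomorph.continuous.continuousAt hO)
    filter_upwards [ih hw hO'] with y hy
    obtain ⟨_, ⟨y', hy', rfl⟩, hy⟩ := hy
    exact ⟨S.σ y', hy', by rw [iter, hy, Option.bind_some, step_of_mem]⟩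

theorem iterate_orbitMap_eq {x₀ : X} [T2Space X] {k : ℕ} {y : S.orbit x₀} {z : X}
    (h : S.iter k y = some z) : ((S.orbitMap x₀)^[k] y : X) = z := by
  induction k generalizing y with
  | zero => exact Option.some.inj h
  | succ k ih =>
    rw [iter_succ'] at h
    obtain ⟨w, hw, hwz⟩ := Option.bind_eq_some_iff.1 h
    obtain ⟨hyU, rfl⟩ := mem_U_of_step_eq hw
    rw [Function.iterate_succ_apply]
    exact ih (by rwa [S.orbitMap_of_mem x₀ y hyU])

end Dynamics

/-! ### Fibres of admissible sets -/

section Fibers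

variable {X : Type u} [TopologicalSpace X] [T2Space X] {S : SGDS X}

theorem IsAdmissible.fiber_eq_of_iter {Y : Set (X × Circle)} (hY : S.IsAdmissible Y) {n : ℕ}
    {x y : X} (h : S.iter n x = some y) : fiber Y x = fiber Y y := by
  induction n generalizing y with
  | zero => rw [Option.some.inj h]
  | succ n ih =>
    obtain ⟨w, hw, hwy⟩ := Option.bind_eq_some_iff.1 h
    obtain ⟨hwU, rfl⟩ := mem_U_of_step_eq hwy
    rw [ih hw]
    exact hY.fiber_eq ⟨w, hwU⟩

theorem IsAdmissible.fiber_eq_of_mem_orbit {Y : Set (X × Circle)} (hY : S.IsAdmissible Y)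
    {x₀ x : X} (h : x ∈ S.orbit x₀) : fiber Y x = fiber Y x₀ := by
  obtain ⟨n, m, y, h₁, h₂⟩ := h
  rw [hY.fiber_eq_of_iter h₁, hY.fiber_eq_of_iter h₂]

theorem isPrimitiveRoot_zeta {n : ℕ} (hn : 1 ≤ n) : IsPrimitiveRoot (zeta n : ℂ) n := by
  have h := Complex.isPrimitiveRoot_exp n (by omega)
  rw [zeta, Circle.coe_exp]
  convert h using 2
  push_cast
  ring

/-- A set of unit complex numbers that is invariant under the rotation by `ζ_n` contains, together
with `γ`, all `n`-th roots of `γ ^ n`. -/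
theorem exists_mem_of_pow_eq {n : ℕ} (hn : 1 ≤ n) {A : Set Circle}
    (hA : (fun γ => zeta n * γ) '' A = A) {γ : Circle} (hγ : γ ∈ A) {z : ℂ}
    (hz : z ^ n = (γ : ℂ) ^ n) : ∃ γ' ∈ A, (γ' : ℂ) = z := by
  have hγ0 : (γ : ℂ) ≠ 0 := γ.coe_ne_zero
  have h1 : (z / γ) ^ n = 1 := by rw [div_pow, hz, div_self (pow_ne_zero n hγ0)]
  have : NeZero n := ⟨by omega⟩
  obtain ⟨i, -, hi⟩ := (isPrimitiveRoot_zeta hn).eq_pow_of_pow_eq_one h1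
  have hmem : ∀ i : ℕ, zeta n ^ i * γ ∈ A := by
    intro i
    induction i with
    | zero => simpa using hγ
    | succ i ih =>
      rw [pow_succ', mul_assoc, ← hA]
      exact ⟨_, ih, rfl⟩
  refine ⟨_, hmem i, ?_⟩
  rw [Circle.coe_mul, Circle.coe_pow, hi, div_mul_cancel₀ _ hγ0]

end Fibers

/-! ### Cutoff functions -/

section Cutoffs

variable {X : Type u} [TopologicalSpace X] [T2Space X] [LocallyCompactSpace X] (S : SGDS X)

theorem exists_C₀_bump {x : X} {W : Set X} (hW : W ∈ nhds x) :
    ∃ f : C₀(X, ℂ), f x = 1 ∧ (∀ y ∉ W, f y = 0) ∧ ‖f‖ ≤ 1 := by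
  obtain ⟨g, hg1, hg0, hgc, hg⟩ := exists_continuous_one_zero_of_isCompact
    (isCompact_singleton (x := x)) (isOpen_interior (s := W)).isClosed_compl
    (by simpa using mem_interior_iff_mem_nhds.2 hW)
  let f : C_c(X, ℂ) := ⟨⟨fun y => (g y : ℂ), by fun_prop⟩,
    hgc.comp_left (g := fun t : ℝ => (t : ℂ)) Complex.ofReal_zero⟩
  have hf : ∀ y, toC₀ f y = (g y : ℂ) := fun y => rfl
  refine ⟨toC₀ f, ?_, fun y hy => ?_, ?_⟩
  · rw [hf, hg1 rfl]
    simp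
  · rw [hf, hg0 fun h => hy (interior_subset h)]
    simp
  · rw [← ZeroAtInftyContinuousMap.norm_toBCF_eq_norm,
      BoundedContinuousFunction.norm_le zero_le_one]
    intro y
    change ‖(g y : ℂ)‖ ≤ 1
    rw [Complex.norm_real, Real.norm_eq_abs, abs_le]
    exact ⟨by linarith [(hg y).1], (hg y).2⟩

/-- A finite subset of `U` has a neighbourhood on which some function in `C_c(U)` is `1`. -/
theorem exists_extendZero_eventually_eq_one {K : Set X} (hK : K.Finite) (hKU : K ⊆ S.U) :
    ∃ ξ : C_c(S.U, ℂ), ∀ z ∈ K, ∀ᶠ y in nhds z, S.extendZero ξ y = 1 := by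
  have : LocallyCompactSpace S.U := S.U.isOpen.locallyCompactSpace
  have hK' : IsCompact (Subtype.val ⁻¹' K : Set S.U) :=
    (hK.preimage Subtype.val_injective.injOn).isCompact
  obtain ⟨L, hL, hKL⟩ := exists_compact_superset hK'
  obtain ⟨g, hg1, -, hgc, -⟩ := exists_continuous_one_zero_of_isCompact hL isClosed_empty
    (Set.disjoint_empty L)
  refine ⟨⟨⟨fun y => (g y : ℂ), by fun_prop⟩,
    hgc.comp_left (g := fun t : ℝ => (t : ℂ)) Complex.ofReal_zero⟩, fun z hz => ?_⟩
  have hzL : Subtype.val '' interior L ∈ nhds z :=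
    S.U.isOpen.isOpenEmbedding_subtypeVal.isOpenMap.image_mem_nhds (x := ⟨z, hKU hz⟩)
      (isOpen_interior.mem_nhds (hKL hz))
  filter_upwards [hzL] with y hy
  obtain ⟨y, hy, rfl⟩ := hy
  rw [S.extendZero_of_mem _ y.2]
  change (g y : ℂ) = 1
  rw [hg1 (interior_subset hy)]
  simp

end Cutoffs

/-! ### Norms of operators in the orbit representations -/

section RepEstimates

variable {X : Type u} [TopologicalSpace X] [T2Space X] (S : SGDS X)

theorem repT1_pow_apply (x₀ : X) (γ : Circle) (ξ : C_c(S.U, ℂ)) {k : ℕ} {y : S.orbit x₀}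
    (hy : ∀ j < k, S.extendZero ξ ((S.orbitMap x₀)^[j] y) = 1) (h : S.H x₀) :
    (S.repT1 x₀ γ ξ ^ k) h y = (γ : ℂ) ^ k * h ((S.orbitMap x₀)^[k] y) := by
  induction k generalizing y with
  | zero => simp
  | succ k ih =>
    have h0 : S.extendZero ξ y = 1 := hy 0 k.succ_pos
    rw [pow_succ', mul_apply_eq_comp, S.repT1_apply, h0, ih fun j hj => hy (j + 1) (by omega),
      Function.iterate_succ_apply]
    ring

/-- The operators `π(t⁰(f) t¹(ξ)ᵏ)`, also for `k = 0`, where the power makes sense only in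
`B(H_x)`. -/
theorem exists_rep_eq_repT0_mul_repT1_pow (f : C₀(X, ℂ)) (ξ : C_c(S.U, ℂ)) (k : ℕ) :
    ∃ a : S.CStar, ∀ x γ, S.rep x γ a = S.repT0 x f * S.repT1 x γ ξ ^ k := by
  induction k with
  | zero => exact ⟨S.universalPair.t0 f, fun x γ => by rw [pow_zero, mul_one]; rfl⟩
  | succ k ih =>
    obtain ⟨a, ha⟩ := ih
    refine ⟨a * S.universalPair.t1 ξ, fun x γ => ?_⟩
    rw [map_mul, ha, pow_succ, mul_assoc]
    rfl

theorem norm_repT0_le (x₀ : X) (f : C₀(X, ℂ)) : ‖S.repT0 x₀ f‖ ≤ ‖f‖ := by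
  unfold repT0 weightedComp
  exact LinearMap.mkContinuous_norm_le _ (norm_nonneg f) _

open Polynomial in
/-- The upper bound for the image of `(t⁰(f) + c t⁰(f) t¹(ξ)ᵖ) / 2`: if `σ ^ n` fixes the points of
the orbit at which `f` does not vanish, then only the `n`-th roots of `γ ^ n` matter. -/
theorem norm_repT0_mul_one_add_le (x₀ : X) (γ : Circle) {f : C₀(X, ℂ)} (hf : ‖f‖ ≤ 1)
    (ξ : C_c(S.U, ℂ)) (c : ℂ) {n p : ℕ} (hn : 1 ≤ n) {r : ℝ} (hr : 0 ≤ r)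
    (hfix : ∀ y : S.orbit x₀, f y ≠ 0 → S.iter n y = some (y : X))
    (hξ : ∀ y : S.orbit x₀, f y ≠ 0 →
      ∀ j < p, S.extendZero ξ ((S.orbitMap x₀)^[j] y) = 1)
    (hz : ∀ z : ℂ, z ^ n = (γ : ℂ) ^ n → ‖(1 / 2 : ℂ) * (1 + c * z ^ p)‖ ≤ r) :
    ‖(1 / 2 : ℂ) • (S.repT0 x₀ f + c • (S.repT0 x₀ f * S.repT1 x₀ γ ξ ^ p))‖ ≤ r := by
  classical
  -- On the points fixed by `σ ^ n` the map `σ` is a permutation of order dividing `n`; the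
  -- permutation `τ` extends it by the identity to the whole orbit.
  let τ₀ : S.orbit x₀ → S.orbit x₀ :=
    fun y => if S.iter n y = some (y : X) then S.orbitMap x₀ y else y
  have hC : ∀ y : S.orbit x₀, S.iter n y = some (y : X) → ∀ k,
      τ₀^[k] y = (S.orbitMap x₀)^[k] y ∧
        S.iter n ((S.orbitMap x₀)^[k] y) = some (((S.orbitMap x₀)^[k] y : S.orbit x₀) : X) := by
    intro y hy k
    induction k with
    | zero => exact ⟨rfl, hy⟩
    | succ k ih =>
      refine ⟨?_, ?_⟩
      · rw [Function.iterate_succ_apply', Function.iterate_succ_apply', ih.1]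
        exact if_pos ih.2
      · obtain ⟨z, hz⟩ := exists_iter_eq_of_iter_eq_self hn hy (k + 1)
        rw [iterate_orbitMap_eq hz]
        exact iter_eq_self_of_iter_eq hy hz
  have hτ : τ₀^[n] = id := by
    funext y
    by_cases hy : S.iter n y = some (y : X)
    · rw [(hC y hy n).1]
      exact Subtype.ext (iterate_orbitMap_eq hy)
    · exact Function.iterate_fixed (show τ₀ y = y from if_neg hy) n
  obtain ⟨m, rfl⟩ : ∃ m, n = m + 1 := ⟨n - 1, by omega⟩
  let τ : S.orbit x₀ ≃ S.orbit x₀ :=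
    { toFun := τ₀
      invFun := τ₀^[m]
      left_inv := fun y => by rw [← Function.iterate_succ_apply, hτ]; rfl
      right_inv := fun y => by
        rw [← Function.iterate_succ_apply' τ₀ m y, hτ]
        rfl }
  let v := permOp (γ : ℂ) τ
  have hvn : v ^ (m + 1) = algebraMap ℂ _ ((γ : ℂ) ^ (m + 1)) := by
    ext h y
    rw [permOp_pow_apply, Algebra.algebraMap_eq_smul_one]
    change _ * h (τ₀^[m + 1] y) = _ * h y
    rw [hτ, id]
  let q : ℂ[X] := C (1 / 2) * (1 + C c * Polynomial.X ^ p)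
  have hq : aeval v q = (1 / 2 : ℂ) • (1 + c • v ^ p) := by
    simp [q, Algebra.algebraMap_eq_smul_one]
  have hv : ‖aeval v q‖ ≤ r := by
    refine norm_aeval_le_of_pow_eq (isStarNormal_permOp _ _) hvn q hr fun z hzn => ?_
    simpa [q] using hz z hzn
  have key : (1 / 2 : ℂ) • (S.repT0 x₀ f + c • (S.repT0 x₀ f * S.repT1 x₀ γ ξ ^ p)) =
      S.repT0 x₀ f * aeval v q := by
    rw [hq, mul_smul_comm, mul_add, mul_one, mul_smul_comm]
    congr 3
    ext h y
    rw [mul_apply_eq_comp, mul_apply_eq_comp, S.repT0_apply, S.repT0_apply]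
    by_cases hy : f y = 0
    · rw [hy, zero_mul, zero_mul]
    · rw [S.repT1_pow_apply x₀ γ ξ (hξ y hy), permOp_pow_apply]
      change _ = _ * (_ * h (τ₀^[p] y))
      rw [(hC y (hfix y hy) p).1]
  rw [key]
  calc _ ≤ ‖S.repT0 x₀ f‖ * ‖aeval v q‖ := norm_mul_le _ _
    _ ≤ 1 * r := mul_le_mul ((S.norm_repT0_le x₀ f).trans hf) hv (norm_nonneg _) zero_le_one
    _ = r := one_mul r

/-- The lower bound for the image of `(t⁰(f) + γ⁻ᵖ t⁰(f) t¹(ξ)ᵖ) / 2`, from its diagonal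
coefficient at a point of the orbit that `σ ^ p` fixes. -/
theorem one_le_norm_repT0_mul_one_add (x₀ : X) (γ : Circle) {f : C₀(X, ℂ)} (ξ : C_c(S.U, ℂ))
    {p : ℕ} (x₁ : S.orbit x₀) (hf : f x₁ = 1) (hp : S.iter p x₁ = some (x₁ : X))
    (hξ : ∀ j < p, S.extendZero ξ ((S.orbitMap x₀)^[j] x₁) = 1) :
    1 ≤ ‖(1 / 2 : ℂ) • (S.repT0 x₀ f +
      conj ((γ : ℂ) ^ p) • (S.repT0 x₀ f * S.repT1 x₀ γ ξ ^ p))‖ := by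
  classical
  set T := (1 / 2 : ℂ) • (S.repT0 x₀ f +
      conj ((γ : ℂ) ^ p) • (S.repT0 x₀ f * S.repT1 x₀ γ ξ ^ p)) with hT
  have hd : ‖S.delta x₀ x₁‖ = 1 := by
    rw [delta, lp.norm_single (by norm_num), norm_one]
  have hTd : T (S.delta x₀ x₁) x₁ = 1 := by
    change (1 / 2 : ℂ) * (S.repT0 x₀ f (S.delta x₀ x₁) x₁ +
      conj ((γ : ℂ) ^ p) * S.repT0 x₀ f ((S.repT1 x₀ γ ξ ^ p) (S.delta x₀ x₁)) x₁) = 1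
    rw [S.repT0_apply, S.repT0_apply, S.repT1_pow_apply x₀ γ ξ hξ,
      Subtype.ext (iterate_orbitMap_eq hp), delta_apply, if_pos rfl, hf, one_mul, one_mul, mul_one,
      Complex.conj_mul', norm_pow, Circle.norm_coe]
    norm_num
  calc (1 : ℝ) = ‖T (S.delta x₀ x₁) x₁‖ := by rw [hTd, norm_one]
    _ ≤ ‖T (S.delta x₀ x₁)‖ := lp.norm_apply_le_norm (by norm_num) _ _
    _ ≤ ‖T‖ * ‖S.delta x₀ x₁‖ := T.le_opNorm _
    _ = ‖T‖ := by rw [hd, mul_one]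

end RepEstimates

/-! ### Ideals and admissible sets -/

section Ideals

variable {X : Type u} [TopologicalSpace X] [T2Space X] {S : SGDS X}

theorem mem_idealOf_iff {Y : Set (X × Circle)} {a : S.CStar} :
    a ∈ S.idealOf Y ↔ ∀ p ∈ Y, S.rep p.1 p.2 a = 0 := by
  simp only [idealOf, P, TwoSidedIdeal.mem_iInf, TwoSidedIdeal.mem_ker, Subtype.forall]

theorem subset_subsetOf_idealOf (Y : Set (X × Circle)) : Y ⊆ S.subsetOf (S.idealOf Y) :=
  fun p hp => iInf_le (fun p : Y => S.P p.1.1 p.1.2) ⟨p, hp⟩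

/-- If `I_Y ⊆ P_{(x,γ)}`, then `π_{(x,γ)}` is dominated in norm by the representations over `Y`. -/
theorem norm_rep_le_of_mem_subsetOf {Y : Set (X × Circle)} {p : X × Circle}
    (hp : p ∈ S.subsetOf (S.idealOf Y)) {a : S.CStar} {M : ℝ} (hM : 0 ≤ M)
    (ha : ∀ q ∈ Y, ‖S.rep q.1 q.2 a‖ ≤ M) : ‖S.rep p.1 p.2 a‖ ≤ M :=
  NonUnitalStarAlgHom.norm_apply_le_of_forall_norm_le (fun q : Y => S.rep q.1.1 q.1.2)
    (S.rep p.1 p.2)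
    (fun _ h => (TwoSidedIdeal.mem_ker _).1 (hp (mem_idealOf_iff.2 fun q hq => h ⟨q, hq⟩)))
    hM fun q => ha q.1 q.2

theorem norm_half_mul_one_add_lt_one {u : ℂ} (hu : ‖u‖ = 1) (h : u ≠ 1) :
    ‖(1 / 2 : ℂ) * (1 + u)‖ < 1 := by
  have h1 : ‖1 + u‖ < ‖(1 : ℂ)‖ + ‖u‖ := by
    refine norm_add_lt_of_not_sameRay fun hs => h ?_
    exact ((sameRay_iff_of_norm_eq (by rw [hu, norm_one])).1 hs).symm
  rw [norm_one, hu] at h1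
  rw [norm_mul]
  norm_num
  linarith

variable {Y : Set (X × Circle)}

/-- The projection to `X` of the part of a closed set that lies over a closed subset of `𝕋` is
closed, as `𝕋` is compact. -/
theorem isClosed_setOf_exists_mem_fiber (hY : IsClosed Y) {A : Set Circle} (hA : IsClosed A) :
    IsClosed {x | ∃ γ ∈ fiber Y x, γ ∈ A} := by
  have h := isClosedMap_fst_of_compactSpace (X := X) (Y := Circle) _
    (hY.inter (hA.preimage continuous_snd))
  convert h using 1
  ext x
  constructor
  · rintro ⟨γ, h1, h2⟩
    exact ⟨(x, γ), ⟨h1, h2⟩, rfl⟩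
  · rintro ⟨⟨x, γ⟩, ⟨h1, h2⟩, rfl⟩
    exact ⟨γ, h1, h2⟩

theorem IsAdmissible.notMem_of_fiber_eq_empty [LocallyCompactSpace X] (hY : S.IsAdmissible Y)
    {x₀ : X} (γ₀ : Circle) (hx₀ : fiber Y x₀ = ∅) : (x₀, γ₀) ∉ S.subsetOf (S.idealOf Y) := by
  intro hmem
  have hcl := isClosed_setOf_exists_mem_fiber hY.isClosed isClosed_univ
  obtain ⟨f, hf1, hf0, -⟩ := exists_C₀_bump (hcl.isOpen_compl.mem_nhds
    (show x₀ ∉ {x | ∃ γ ∈ fiber Y x, γ ∈ Set.univ} by simp [hx₀]))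
  have h0 := (TwoSidedIdeal.mem_ker _).1 (hmem (x := S.universalPair.t0 f)
    (mem_idealOf_iff.2 fun q hq => ?_))
  · have h1 : S.rep x₀ γ₀ (S.universalPair.t0 f) (S.delta x₀ ⟨x₀, mem_orbit_self x₀⟩)
        ⟨x₀, mem_orbit_self x₀⟩ = 1 := by
      classical
      rw [rep_t0_delta]
      change f x₀ * _ = 1
      rw [hf1, one_mul, delta_apply, if_pos rfl]
    rw [h0] at h1
    exact zero_ne_one h1
  · change S.repT0 q.1 f = 0
    ext h y
    rw [S.repT0_apply, hf0 y, zero_mul]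
    · rfl
    · rw [Set.notMem_compl_iff]
      exact ⟨q.2, by rw [hY.fiber_eq_of_mem_orbit y.2]; exact hq, Set.mem_univ _⟩

/-- A point of `X` with a fibre that is neither empty nor full has an iterate which lies on a
cycle. -/
theorem IsAdmissible.exists_iter_eq_self (hY : S.IsAdmissible Y) {x₀ : X}
    (h : fiber Y x₀ ≠ ∅) (h' : fiber Y x₀ ≠ Set.univ) :
    ∃ k x₁ p, S.iter k x₀ = some x₁ ∧ S.period x₁ = (p : ℕ) ∧ 1 ≤ p ∧
      S.iter p x₁ = some x₁ := by
  obtain ⟨k, n, hn, hk⟩ := (hY.of_ne x₀ h h').1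
  obtain ⟨k, x₁, h₁, h₂⟩ := (exists_iterEq_add_iff n x₀).1 ⟨k, hk⟩
  obtain ⟨p, hp⟩ := exists_period_eq_of_iter_eq_self hn h₂
  exact ⟨k, x₁, p, h₁, hp⟩

theorem IsAdmissible.notMem_of_fiber_ne [LocallyCompactSpace X] (hY : S.IsAdmissible Y)
    {x₀ : X} {γ₀ : Circle} (hx₀ : fiber Y x₀ ≠ ∅) (hγ₀ : (x₀, γ₀) ∉ Y) :
    (x₀, γ₀) ∉ S.subsetOf (S.idealOf Y) := by
  intro hmem
  have hu : ∀ {x}, γ₀ ∉ fiber Y x → fiber Y x ≠ Set.univ := fun h h' => h (h' ▸ Set.mem_univ γ₀)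
  obtain ⟨k, x₁, p, hk, hp, hp1, hpx⟩ := hY.exists_iter_eq_self hx₀ (hu hγ₀)
  have hx₁ : x₁ ∈ S.orbit x₀ := ⟨0, k, x₁, rfl, hk⟩
  have hfib : fiber Y x₁ = fiber Y x₀ := hY.fiber_eq_of_mem_orbit hx₁
  have hne : fiber Y x₁ ≠ ∅ := by rwa [hfib]
  have hγ₁ : γ₀ ∉ fiber Y x₁ := by rw [hfib]; exact hγ₀
  obtain ⟨-, hζ, V, hV, hVY⟩ := hY.of_ne x₁ hne (hu hγ₁)
  rw [hp, ENat.toNat_natCast] at hζ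
  -- `c` is the inverse of `γ₀ ^ p`.
  let c : ℂ := conj ((γ₀ : ℂ) ^ p)
  have hc : c * (γ₀ : ℂ) ^ p = 1 := by
    rw [Complex.conj_mul', norm_pow, Circle.norm_coe]
    norm_num
  let φ : Circle → ℝ := fun γ => ‖(1 / 2 : ℂ) * (1 + c * (γ : ℂ) ^ p)‖
  have hφc : Continuous φ := by fun_prop
  have hφγ₀ : φ γ₀ = 1 := by
    simp only [φ, hc]
    norm_num
  -- Equality would make `γ₀` a `p`-th root of `γ ^ p`, hence an element of the fibre.
  have hφ : ∀ γ ∈ fiber Y x₁, φ γ < 1 := by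
    intro γ hγ
    refine norm_half_mul_one_add_lt_one ?_ fun hcon => hγ₁ ?_
    · rw [norm_mul, norm_pow, Circle.norm_coe, Complex.norm_conj, norm_pow, Circle.norm_coe]
      norm_num
    · have hc0 : c ≠ 0 := left_ne_zero_of_mul_eq_one hc
      obtain ⟨γ', hγ', h⟩ := exists_mem_of_pow_eq hp1 hζ hγ (z := γ₀)
        (mul_left_cancel₀ hc0 (hc.trans hcon.symm))
      rwa [← Circle.ext h]
  obtain ⟨r, hr0, hr1, hr⟩ : ∃ r : ℝ, 0 ≤ r ∧ r < 1 ∧ ∀ γ ∈ fiber Y x₁, φ γ < r := by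
    have hcpt : IsCompact (fiber Y x₁) :=
      (hY.isClosed.preimage (Continuous.prodMk_right x₁)).isCompact
    obtain ⟨γm, hγm, hmax⟩ := hcpt.exists_isMaxOn (Set.nonempty_iff_ne_empty.2 hne)
      hφc.continuousOn
    have h0 : 0 ≤ φ γm := norm_nonneg _
    have h1 := hφ γm hγm
    refine ⟨(φ γm + 1) / 2, by linarith, by linarith, fun γ hγ => ?_⟩
    have h2 : φ γ ≤ φ γm := hmax hγ
    linarith
  have hV' : ∀ᶠ y in nhds x₁, ∀ γ ∈ fiber Y y, φ γ < r := by
    have hcl := isClosed_setOf_exists_mem_fiber hY.isClosed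
      (isClosed_le continuous_const hφc : IsClosed {γ | r ≤ φ γ})
    filter_upwards [hcl.isOpen_compl.mem_nhds (show x₁ ∉ {x | ∃ γ ∈ fiber Y x, γ ∈ {γ | r ≤ φ γ}}
      from fun ⟨γ, h1, h2⟩ => (hr γ h1).not_ge h2)] with y hy γ hγ
    exact lt_of_not_ge fun h => hy ⟨γ, hγ, h⟩
  -- `ξ` is `1` near the cycle of `x₁`.
  obtain ⟨ξ, hξ⟩ := S.exists_extendZero_eventually_eq_one
    (K := {z | ∃ j < p, S.iter j x₁ = some z})
    ((Set.finite_lt_nat p).biUnion' (t := fun j _ => {z | S.iter j x₁ = some z})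
      (fun j _ => Set.Subsingleton.finite fun a ha b hb => Option.some.inj (ha.symm.trans hb))
      |>.subset fun z ⟨j, hj, hz⟩ => Set.mem_biUnion (x := j) hj hz)
    (by
      rintro z ⟨j, -, hz⟩
      obtain ⟨w, hw⟩ := exists_iter_eq_of_iter_eq_self hp1 hpx (j + 1)
      rw [iter, hz] at hw
      exact (mem_U_of_step_eq hw).1)
  have hW : ∀ᶠ y in nhds x₁, ∀ j < p, ∃ w, S.extendZero ξ w = 1 ∧ S.iter j y = some w := by
    refine (Set.finite_lt_nat p).eventually_all.2 fun j hj => ?_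
    obtain ⟨z, hz⟩ := exists_iter_eq_of_iter_eq_self hp1 hpx j
    exact eventually_iter hz (hξ z ⟨j, hj, hz⟩)
  obtain ⟨f, hf1, hf0, hf⟩ := exists_C₀_bump (Filter.inter_mem hV (hV'.and hW))
  have hξ' : ∀ {x} (y : S.orbit x), f y ≠ 0 →
      ∀ j < p, S.extendZero ξ ((S.orbitMap x)^[j] y) = 1 := by
    intro x y hy j hj
    obtain ⟨w, hw, hwy⟩ := (not_imp_comm.1 (hf0 y) hy).2.2 j hj
    rwa [iterate_orbitMap_eq hwy]
  obtain ⟨a, ha⟩ := S.exists_rep_eq_repT0_mul_repT1_pow f ξ p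
  let b : S.CStar := (1 / 2 : ℂ) • (S.universalPair.t0 f + c • a)
  have hb : ∀ x γ, S.rep x γ b =
      (1 / 2 : ℂ) • (S.repT0 x f + c • (S.repT0 x f * S.repT1 x γ ξ ^ p)) := by
    intro x γ
    rw [map_smul, map_add, map_smul, ha]
    rfl
  have hbY : ∀ q ∈ Y, ‖S.rep q.1 q.2 b‖ ≤ r := by
    rintro ⟨x, γ⟩ hq
    rw [hb]
    by_cases hfx : ∀ y : S.orbit x, f y = 0
    · have : S.repT0 x f = 0 := by
        ext h y
        rw [S.repT0_apply, hfx, zero_mul]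
        rfl
      simpa [this] using hr0
    push Not at hfx
    obtain ⟨y₀, hy₀⟩ := hfx
    -- The support of `f` is so small that the points of `Orb(x)` in it lie on a cycle.
    have hpre : ∀ y : S.orbit x, f y ≠ 0 → S.preperiod y = 0 := by
      intro y hy
      have hyV := (not_imp_comm.1 (hf0 y) hy).1
      rw [← preperiod_eq_zero_of_iter_eq_self hp1 hpx]
      by_contra hcon
      have h1 := hVY y hyV hcon
      rw [hY.fiber_eq_of_mem_orbit y.2] at h1
      exact (h1 ▸ hq : γ ∈ (∅ : Set Circle))
    -- The period is constant on the orbit, so one `n` serves for all these points.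
    obtain ⟨n, hn, -⟩ := exists_iter_eq_self_of_preperiod_eq_zero (hpre y₀ hy₀)
    have hn1 := (exists_iter_eq_of_period_eq hn).1
    refine S.norm_repT0_mul_one_add_le x γ hf ξ c hn1 hr0 (fun y hy => ?_) hξ' fun z hz => ?_
    · obtain ⟨m, hm, hmy⟩ := exists_iter_eq_self_of_preperiod_eq_zero (hpre y hy)
      rw [period_eq_of_mem_orbit y.2, ← period_eq_of_mem_orbit y₀.2, hn] at hm
      obtain rfl : n = m := by exact_mod_cast hm
      exact hmy
    -- `γ₀` is missing from the fibre over `y₀`, where `φ < r < 1`, so the fibre is not all of `𝕋`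
    -- and is invariant under the rotation by `ζ_n`.
    · have hlt := (not_imp_comm.1 (hf0 y₀) hy₀).2.1
      have hγ : γ ∈ fiber Y y₀ := by rw [hY.fiber_eq_of_mem_orbit y₀.2]; exact hq
      have hγ₀' : γ₀ ∉ fiber Y y₀ := fun h => by
        have := hlt γ₀ h
        linarith
      have hζ' := (hY.of_ne y₀ (Set.nonempty_iff_ne_empty.1 ⟨γ, hγ⟩) (hu hγ₀')).2.1
      rw [hn, ENat.toNat_natCast] at hζ'
      obtain ⟨γ', hγ', rfl⟩ := exists_mem_of_pow_eq hn1 hζ' hγ hz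
      exact (hlt γ' hγ').le
  have h1 := norm_rep_le_of_mem_subsetOf hmem hr0 hbY
  have h2 := S.one_le_norm_repT0_mul_one_add x₀ γ₀ ξ ⟨x₁, hx₁⟩ hf1 hpx
    (hξ' _ (by rw [hf1]; exact one_ne_zero))
  rw [hb] at h1
  linarith

end Ideals

end SGDS

theorem mainTheorem7 {X : Type*} [TopologicalSpace X] [LocallyCompactSpace X] [T2Space X]
    (S : SGDS X) (Y : Set (X × Circle)) (hY : S.IsAdmissible Y) :
    S.subsetOf (S.idealOf Y) = Y := by
  refine Set.Subset.antisymm (fun p hp => ?_) (SGDS.subset_subsetOf_idealOf Y)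
  by_contra hpY
  by_cases hx : SGDS.fiber Y p.1 = ∅
  · exact hY.notMem_of_fiber_eq_empty p.2 hx hp
  · exact hY.notMem_of_fiber_ne hx hpY hp
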